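/- For a positive integer $m$, subsets $B,D\subseteq\mathbb{Z}_m=\mathbb{Z}/m\mathbb{Z}$ are called $2$-$\{m;k_1,k_2;\mu\}$ \emph{almost supplementary difference sets} (ASDS), where $\mu\ge 0$ is an integer, if $|B|=k_1$, $|D|=k_2$, and for every nonzero $a\in\mathbb{Z}_m$ the number of pairs $(x,x')\in B\times B$ with $x-x'=a$ plus the number of pairs $(y,y')\in D\times D$ with $y-y'=a$ equals $\mu$ or $\mu+1$; if there are exactly $t$ nonzero $a$ for which this total is $\mu$, one also writes $2$-$\{m;k_1,k_2;\mu;t\}$, and $t$ is determined by the other parameters. Let $m$ be an odd positive integer such that $m$ is a prime with $m\equiv 1 \pmod 4$, or $2m-1$ is a prime power. Then there exist subsets $B,D\subseteq\mathbb{Z}_m$ that are $2$-$\{m;|B|,|D|;|B|+|D|-\frac{m+1}{2}\}$ ASDS (in particular $|B|+|D|\ge\frac{m+1}{2}$) such that the multiset $B-D$ of differences $x-y\in\mathbb{Z}_m$, as $(x,y)$ ranges over $B\times D$, is symmetric, i.e. closed under negation. -/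

import Mathlib

/-- The number of pairs `(x, y)` in `S × S` with `x - y = a` in `ℤ/mℤ`. -/
def diffCount {m : ℕ} (S : Finset (ZMod m)) (a : ZMod m) : ℕ :=
  ((S ×ˢ S).filter (fun p => p.1 - p.2 = a)).card

/-- `B` and `D` are `2-{m; k₁, k₂; μ; t}` almost supplementary difference sets in `ℤ/mℤ`:
`|B| = k₁`, `|D| = k₂`, and among the nonzero residues `a` there are exactly `t` for which
`x - x' = a` (with `x, x' ∈ B`) and `y - y' = a` (with `y, y' ∈ D`) have together exactly `μ`
solutions, while for all the remaining nonzero `a` they have together exactly `μ + 1`. -/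
structure IsASDSWith {m : ℕ} [NeZero m] (B D : Finset (ZMod m)) (k₁ k₂ μ t : ℕ) : Prop where
  card_left : B.card = k₁
  card_right : D.card = k₂
  card_eq : (Finset.univ.filter
    (fun a : ZMod m => a ≠ 0 ∧ diffCount B a + diffCount D a = μ)).card = t
  remaining : ∀ a : ZMod m, a ≠ 0 → diffCount B a + diffCount D a ≠ μ →
    diffCount B a + diffCount D a = μ + 1

/-- `2-{m; k₁, k₂; μ}` almost supplementary difference sets; the number `t` is determined by the
other parameters and is left out. -/
def IsASDS {m : ℕ} [NeZero m] (B D : Finset (ZMod m)) (k₁ k₂ μ : ℕ) : Prop :=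
  ∃ t : ℕ, IsASDSWith B D k₁ k₂ μ t

/-- The multiset `B - D` of differences `x - y`, as `(x, y)` ranges over `B × D`. -/
def diffMultiset {m : ℕ} (B D : Finset (ZMod m)) : Multiset (ZMod m) :=
  (B ×ˢ D).val.map (fun p => p.1 - p.2)

/-- A multiset in `ℤ/mℤ` is symmetric if it is closed under negation, with multiplicities. -/
def IsSymmMultiset {m : ℕ} (M : Multiset (ZMod m)) : Prop :=
  M.map (fun a => -a) = M

/-! It suffices to find even ±1 sequences on `ZMod m` whose autocorrelations sum to ±2 at every
nonzero shift: `B` and `D` are the places where they equal -1, and evenness makes `B - D` symmetric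
(`exists_asds_of_autocorrelation`). For a prime m ≡ 1 mod 4, take χ and -χ, χ the quadratic
character, with value 1 put at 0; the total is always -2. For a prime power q = 2m - 1, let χ be the
quadratic character of the field with q elements. Analogues A, B of sine and cosine at the m-th
roots of unity take values in this field, and the autocorrelations of χ∘A and χ∘B cancel
(`sum_eq_zero_of_moebius`). Replacing the zero of ±χ∘A at 0 by 1 turns the total into ±2. -/

/-! ### From ±1 sequences to almost supplementary difference sets. -/

/-- The periodic autocorrelation of `f` at the shift `w`. -/
def autocorrelation {m : ℕ} [NeZero m] (f : ZMod m → ℤ) (w : ZMod m) : ℤ :=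
  ∑ v, f v * f (v + w)

theorem diffCount_eq_card_filter {m : ℕ} [NeZero m] (S : Finset (ZMod m)) (w : ZMod m) :
    diffCount S w = (Finset.univ.filter (fun v => v ∈ S ∧ v + w ∈ S)).card := by
  unfold diffCount
  symm
  refine Finset.card_bij' (fun v _ => (v + w, v)) (fun p _ => p.2) ?_ ?_ ?_ ?_
  · intro v hv
    simp only [Finset.mem_filter, Finset.mem_univ, true_and] at hv
    simp [hv]
  · rintro ⟨x, y⟩ hp
    simp only [Finset.mem_filter, Finset.mem_product] at hp
    obtain ⟨⟨hx, hy⟩, rfl⟩ := hp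
    simp [hx, hy]
  · simp
  · rintro ⟨x, y⟩ hp
    simp only [Finset.mem_filter, Finset.mem_product] at hp
    obtain ⟨⟨hx, hy⟩, rfl⟩ := hp
    simp

/-- The indicator of the set is (1 - f)/2; expand the product of two shifted copies. -/
theorem four_mul_diffCount {m : ℕ} [NeZero m] {f : ZMod m → ℤ} (hf : ∀ v, f v = 1 ∨ f v = -1)
    (w : ZMod m) :
    4 * (diffCount (Finset.univ.filter (fun v => f v = -1)) w : ℤ) =
      4 * ((Finset.univ.filter (fun v => f v = -1)).card : ℤ) - m + autocorrelation f w := by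
  have hshift : ∑ v, f (v + w) = ∑ v, f v := Equiv.sum_comp (Equiv.addRight w) f
  have hcard : 2 * ((Finset.univ.filter (fun v => f v = -1)).card : ℤ) = m - ∑ v, f v := by
    rw [Finset.card_filter]
    push_cast
    have hm : (m : ℤ) = ∑ _v : ZMod m, 1 := by simp [ZMod.card]
    rw [hm, Finset.mul_sum, ← Finset.sum_sub_distrib]
    refine Finset.sum_congr rfl fun v _ => ?_
    rcases hf v with h | h <;> simp [h]
  have hcount : 4 * (diffCount (Finset.univ.filter (fun v => f v = -1)) w : ℤ) =
      ∑ v, (1 - f v) * (1 - f (v + w)) := by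
    rw [diffCount_eq_card_filter, Finset.card_filter]
    push_cast
    rw [Finset.mul_sum]
    refine Finset.sum_congr rfl fun v _ => ?_
    rcases hf v with h | h <;> rcases hf (v + w) with h' | h' <;> simp [h, h']
  have hexp : ∑ v, (1 - f v) * (1 - f (v + w)) =
      m - ∑ v, f v - ∑ v, f (v + w) + autocorrelation f w := by
    have hm : (m : ℤ) = ∑ _v : ZMod m, 1 := by simp [ZMod.card]
    rw [hm, autocorrelation, ← Finset.sum_sub_distrib, ← Finset.sum_sub_distrib,
      ← Finset.sum_add_distrib]
    exact Finset.sum_congr rfl fun v _ => by ring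
  rw [hcount, hexp, hshift]
  linarith

theorem isSymmMultiset_diffMultiset {m : ℕ} {B D : Finset (ZMod m)}
    (hB : ∀ v, -v ∈ B ↔ v ∈ B) (hD : ∀ v, -v ∈ D ↔ v ∈ D) :
    IsSymmMultiset (diffMultiset B D) := by
  have himage : (B ×ˢ D).map (Equiv.neg (ZMod m × ZMod m)).toEmbedding = B ×ˢ D := by
    ext ⟨x, y⟩
    simp [Finset.mem_map_equiv, hB, hD]
  unfold IsSymmMultiset diffMultiset
  conv_rhs => rw [← himage]
  rw [Finset.map_val, Multiset.map_map, Multiset.map_map]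
  refine Multiset.map_congr rfl fun p _ => ?_
  simp
  ring

theorem exists_asds_of_autocorrelation {m : ℕ} [NeZero m] (hodd : Odd m) {f g : ZMod m → ℤ}
    (hf : ∀ v, f v = 1 ∨ f v = -1) (hg : ∀ v, g v = 1 ∨ g v = -1)
    (hfe : ∀ v, f (-v) = f v) (hge : ∀ v, g (-v) = g v)
    (h : ∀ w, w ≠ 0 → autocorrelation f w + autocorrelation g w = 2 ∨
      autocorrelation f w + autocorrelation g w = -2)
    (h' : ∃ w, w ≠ 0 ∧ autocorrelation f w + autocorrelation g w = -2) :
    ∃ (B D : Finset (ZMod m)) (μ : ℕ),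
      (μ : ℤ) = (B.card : ℤ) + (D.card : ℤ) - ((m : ℤ) + 1) / 2 ∧
      IsASDS B D B.card D.card μ ∧
      IsSymmMultiset (diffMultiset B D) := by
  obtain ⟨k, hk⟩ := hodd
  have hF := four_mul_diffCount hf
  have hG := four_mul_diffCount hg
  set B := Finset.univ.filter (fun v => f v = -1) with hB
  set D := Finset.univ.filter (fun v => g v = -1) with hD
  obtain ⟨w₀, -, hw₀⟩ := h'
  have hF₀ := hF w₀
  have hG₀ := hG w₀
  -- The smaller count is attained at `w₀`, so μ is a natural number.
  refine ⟨B, D, diffCount B w₀ + diffCount D w₀, by push_cast; omega,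
    ⟨_, rfl, rfl, rfl, fun a ha hne => ?_⟩, ?_⟩
  · have hFa := hF a
    have hGa := hG a
    rcases h a ha with hh | hh <;> omega
  · exact isSymmMultiset_diffMultiset (by simp [hB, hfe]) (by simp [hD, hge])

/-- Giving the value `1` at `0` to an even sequence that vanishes there. -/
theorem autocorrelation_update_zero {m : ℕ} [NeZero m] {f : ZMod m → ℤ} (h0 : f 0 = 0)
    (hfe : ∀ v, f (-v) = f v) {w : ZMod m} (hw : w ≠ 0) :
    autocorrelation (Function.update f 0 1) w = autocorrelation f w + 2 * f w := by
  have hterm : ∀ v, Function.update f 0 1 v * Function.update f 0 1 (v + w) =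
      f v * f (v + w) + ((if v = 0 then f w else 0) + if v = -w then f w else 0) := by
    intro v
    by_cases hv : v = 0
    · subst hv
      have : (0 : ZMod m) ≠ -w := fun h => hw (by simpa using h.symm)
      simp [hw, h0, this]
    · by_cases hv' : v = -w
      · subst hv'
        simp [hw, h0, hfe]
      · have : v + w ≠ 0 := fun h => hv' (eq_neg_of_add_eq_zero_left h)
        simp [hv, hv', this]
  unfold autocorrelation
  simp only [hterm, Finset.sum_add_distrib, Finset.sum_ite_eq', Finset.mem_univ, if_true]
  ring

/-! ### The prime case. -/

/-- For v ≠ 0 the term is χ(1 + w/v), and 1 + w/v runs over everything except 1. -/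
theorem sum_quadraticChar_mul_shift {F : Type*} [Field F] [Fintype F] [DecidableEq F]
    (hF : ringChar F ≠ 2) {w : F} (hw : w ≠ 0) :
    ∑ v, quadraticChar F v * quadraticChar F (v + w) = -1 := by
  have hsum := quadraticChar_sum_zero hF
  have hre : ∑ v ∈ Finset.univ.erase (0 : F), quadraticChar F v * quadraticChar F (v + w) =
      ∑ t ∈ Finset.univ.erase (1 : F), quadraticChar F t := by
    refine Finset.sum_bij' (fun v _ => 1 + w / v) (fun t _ => w / (t - 1)) ?_ ?_ ?_ ?_ ?_
    · intro v hv
      have : v ≠ 0 := by simpa using hv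
      simp [hw, this]
    · intro t ht
      have : t ≠ 1 := by simpa using ht
      simp [hw, sub_ne_zero.2 this]
    · intro v hv
      have : v ≠ 0 := by simpa using hv
      simp [div_div_cancel₀ hw]
    · intro t ht
      have : t - 1 ≠ 0 := sub_ne_zero.2 (by simpa using ht)
      field_simp
      ring
    · intro v hv
      have hv : v ≠ 0 := by simpa using hv
      have : v * (v + w) = v ^ 2 * (1 + w / v) := by field_simp
      rw [← map_mul, this, map_mul, quadraticChar_sq_one' hv, one_mul]
  rw [← Finset.add_sum_erase _ _ (Finset.mem_univ (0 : F)), hre]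
  rw [← Finset.add_sum_erase _ _ (Finset.mem_univ (1 : F))] at hsum
  simp at hsum ⊢
  linarith

theorem exists_asds_of_prime {m : ℕ} [NeZero m] (hp : m.Prime) (h4 : m ≡ 1 [MOD 4]) :
    ∃ (B D : Finset (ZMod m)) (μ : ℕ),
      (μ : ℤ) = (B.card : ℤ) + (D.card : ℤ) - ((m : ℤ) + 1) / 2 ∧
      IsASDS B D B.card D.card μ ∧
      IsSymmMultiset (diffMultiset B D) := by
  have : Fact m.Prime := ⟨hp⟩
  have h4' : m % 4 = 1 := h4
  have hchar : ringChar (ZMod m) ≠ 2 := by rw [ZMod.ringChar_zmod_n]; omega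
  set χ := quadraticChar (ZMod m) with hχ
  have hneg : χ (-1) = 1 := by
    rw [hχ, quadraticChar_neg_one hchar, ZMod.card, ZMod.χ₄_nat_one_mod_four h4']
  have heven : ∀ v, χ (-v) = χ v := fun v => by rw [neg_eq_neg_one_mul, map_mul, hneg, one_mul]
  have hval : ∀ v ≠ 0, χ v = 1 ∨ χ v = -1 := fun v hv => quadraticChar_dichotomy hv
  have hsum : ∀ w, w ≠ 0 → autocorrelation (fun v => χ v) w = -1 := fun w hw =>
    sum_quadraticChar_mul_shift hchar hw
  have hsum' : ∀ w, w ≠ 0 → autocorrelation (fun v => -χ v) w = -1 := fun w hw => by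
    rw [← hsum w hw]; simp [autocorrelation]
  have htotal : ∀ w, w ≠ 0 → autocorrelation (Function.update (fun v => χ v) 0 1) w +
      autocorrelation (Function.update (fun v => -χ v) 0 1) w = -2 := fun w hw => by
    rw [autocorrelation_update_zero (by simp [hχ]) heven hw,
      autocorrelation_update_zero (by simp [hχ]) (fun v => by rw [heven]) hw, hsum w hw,
      hsum' w hw]
    ring
  refine exists_asds_of_autocorrelation (f := Function.update (fun v => χ v) 0 1)
    (g := Function.update (fun v => -χ v) 0 1) (Nat.odd_iff.2 (by omega)) ?_ ?_ ?_ ?_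
    (fun w hw => Or.inr (htotal w hw)) ⟨1, one_ne_zero, htotal 1 one_ne_zero⟩
  · intro v
    by_cases hv : v = 0
    · simp [hv]
    · simpa [hv] using hval v hv
  · intro v
    by_cases hv : v = 0
    · simp [hv]
    · have := hval v hv
      simp only [Function.update_of_ne hv]
      omega
  · intro v
    by_cases hv : v = 0
    · simp [hv]
    · simp [hv, heven]
  · intro v
    by_cases hv : v = 0
    · simp [hv]
    · simp [hv, heven]

/-! ### The prime power case. -/

/-- The addition formulas make the m - 1 ratios A(v+w)/A(v), v ≠ 0, and the m ratios B(v+w)/B(v)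
pairwise distinct. Being 2m - 1 in number, they exhaust `F`, over which χ sums to zero. -/
theorem sum_eq_zero_of_moebius {m : ℕ} [NeZero m] {F : Type*} [Field F] [Fintype F]
    [DecidableEq F] (hF : ringChar F ≠ 2) (hcard : Fintype.card F = 2 * m - 1)
    {A B : ZMod m → F} (hA : ∀ v, A v = 0 ↔ v = 0) (hB : ∀ v, B v ≠ 0)
    (hAA : ∀ v v' w, A v * A (v' + w) - A v' * A (v + w) = A w * A (v - v'))
    (hAB : ∀ v v' w, A v * B (v' + w) - B v' * A (v + w) = -(A w * B (v - v')))
    {d : F}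
    (hBB : ∀ v v' w, d * (B v * B (v' + w) - B v' * B (v + w)) = -(A w * A (v - v')))
    {w : ZMod m} (hw : w ≠ 0) :
    autocorrelation (fun v => quadraticChar F (A v)) w +
      autocorrelation (fun v => quadraticChar F (B v)) w = 0 := by
  have hAw : A w ≠ 0 := fun h => hw ((hA w).1 h)
  have hA' : ∀ v : {v : ZMod m // v ≠ 0}, A v ≠ 0 := fun v h => v.2 ((hA _).1 h)
  let t : {v : ZMod m // v ≠ 0} ⊕ ZMod m → F :=
    Sum.elim (fun v => A (v + w) / A v) (fun v => B (v + w) / B v)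
  have hmixed : ∀ (v : {v : ZMod m // v ≠ 0}) v', A (v + w) / A v ≠ B (v' + w) / B v' := by
    intro v v' h
    rw [div_eq_div_iff (hA' v) (hB v')] at h
    refine mul_ne_zero hAw (hB (v - v')) ?_
    linear_combination hAB v v' w + h
  have hinj : Function.Injective t := by
    rintro (v | v) (v' | v') h <;> simp only [t, Sum.elim_inl, Sum.elim_inr] at h
    · rw [div_eq_div_iff (hA' v) (hA' v')] at h
      have : A w * A (v - v') = 0 := by linear_combination -hAA v v' w - h
      have := (hA _).1 ((mul_eq_zero.1 this).resolve_left hAw)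
      rw [Subtype.ext (sub_eq_zero.1 this)]
    · exact absurd h (hmixed v v')
    · exact absurd h.symm (hmixed v' v)
    · rw [div_eq_div_iff (hB v) (hB v')] at h
      have : A w * A (v - v') = 0 := by linear_combination hBB v v' w + d * h
      have := (hA _).1 ((mul_eq_zero.1 this).resolve_left hAw)
      rw [sub_eq_zero.1 this]
  have hbij : Function.Bijective t := by
    refine (Fintype.bijective_iff_injective_and_card t).2 ⟨hinj, ?_⟩
    have := NeZero.pos m
    rw [Fintype.card_sum, Fintype.card_subtype_compl, Fintype.card_subtype_eq, ZMod.card, hcard]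
    omega
  have hdiv : ∀ x y : F, x ≠ 0 → quadraticChar F x * quadraticChar F y =
      quadraticChar F (y / x) := by
    intro x y hx
    have : x * y = x ^ 2 * (y / x) := by field_simp
    rw [← map_mul, this, map_mul, quadraticChar_sq_one' hx, one_mul]
  have hsum := quadraticChar_sum_zero hF
  rw [← hbij.sum_comp (fun x => quadraticChar F x), Fintype.sum_sum_type] at hsum
  rw [← hsum]
  unfold autocorrelation
  congr 1
  · rw [← Fintype.sum_subtype_add_sum_subtype (fun v : ZMod m => v ≠ 0)]
    rw [add_eq_left.2]
    · exact Finset.sum_congr rfl fun v _ => hdiv _ _ (hA' v)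
    · refine Finset.sum_eq_zero fun v _ => ?_
      have : (v : ZMod m) = 0 := not_not.1 v.2
      simp [(hA v).2 this]
  · exact Finset.sum_congr rfl fun v _ => hdiv _ _ (hB v)

theorem mem_range_algebraMap_of_pow_card_eq {F K : Type*} [Field F] [Fintype F] [Field K]
    [Algebra F K] {x : K} (hx : x ^ Fintype.card F = x) : ∃ y, algebraMap F K y = x := by
  have hsplits := (FiniteField.isSplittingField_sub F F).splits
  have hne : (Polynomial.X ^ Fintype.card F - Polynomial.X : Polynomial F) ≠ 0 :=
    FiniteField.X_pow_card_sub_X_ne_zero F Fintype.one_lt_card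
  rw [Algebra.algebraMap_self, Polynomial.map_id] at hsplits
  exact hsplits.mem_range_of_isRoot hne (by simp [hx])

/-- The analogues of the sine and cosine at the `m`-th roots of unity in a finite field with
`2m - 1` elements. -/
theorem exists_sine_cosine {m : ℕ} [NeZero m] (hodd : Odd m) {F : Type*} [Field F] [Fintype F]
    (K : Type*) [Field K] [Algebra F K] [IsAlgClosed K]
    (hF : ringChar F ≠ 2) (hcard : Fintype.card F = 2 * m - 1) :
    ∃ (A B : ZMod m → F) (d : F), (∀ v, A v = 0 ↔ v = 0) ∧ (∀ v, B v ≠ 0) ∧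
      (∀ v, A (-v) = -A v) ∧ (∀ v, B (-v) = B v) ∧
      (∀ v v' w, A v * A (v' + w) - A v' * A (v + w) = A w * A (v - v')) ∧
      (∀ v v' w, A v * B (v' + w) - B v' * A (v + w) = -(A w * B (v - v'))) ∧
      (∀ v v' w, d * (B v * B (v' + w) - B v' * B (v + w)) = -(A w * A (v - v'))) := by
  have hm := NeZero.pos m
  have h2 : (2 : F) ≠ 0 := Ring.two_ne_zero hF
  have h2K : (2 : K) ≠ 0 := by
    rw [← map_ofNat (algebraMap F K) 2]
    exact (map_ne_zero (algebraMap F K)).2 h2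
  have hmK : (m : K) ≠ 0 := by
    have h0 : ((2 * m - 1 : ℕ) : F) = 0 := by rw [← hcard]; exact FiniteField.cast_card_eq_zero F
    rw [Nat.cast_sub (by omega)] at h0
    push_cast at h0
    have : (m : F) ≠ 0 := fun h => by simp [h] at h0
    simpa using (map_ne_zero (algebraMap F K)).2 this
  have : NeZero (m : K) := ⟨hmK⟩
  obtain ⟨ζ, hζ⟩ := HasEnoughRootsOfUnity.exists_primitiveRoot K m
  obtain ⟨d, hd⟩ := FiniteField.exists_nonsquare hF
  have hd0 : d ≠ 0 := by rintro rfl; exact hd (IsSquare.zero)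
  obtain ⟨δ, hδ⟩ := IsAlgClosed.exists_pow_nat_eq (algebraMap F K d) (n := 2) two_pos
  have hδ0 : δ ≠ 0 := by
    rintro rfl
    exact hd0 ((map_eq_zero (algebraMap F K)).1 (by rw [← hδ]; simp))
  set q := Fintype.card F with hq
  have hqodd : q = 2 * (q / 2) + 1 := by omega
  -- Euler's criterion for the nonsquare `d = δ ^ 2`.
  have hδq : δ ^ q = -δ := by
    have h1 : d ^ (q / 2) = -1 :=
      (FiniteField.pow_dichotomy hF hd0).resolve_left fun h =>
        hd ((FiniteField.isSquare_iff hF hd0).2 h)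
    rw [hqodd, pow_succ, pow_mul, hδ, ← map_pow, h1]
    simp
  let e := AddChar.zmodChar m hζ.pow_eq_one
  have he0 : ∀ v, e v ≠ 0 := fun v => by
    rw [AddChar.zmodChar_apply]; exact pow_ne_zero _ (hζ.ne_zero hm.ne')
  have heinj : ∀ v, e v = 1 → v = 0 := fun v hv => by
    rw [AddChar.zmodChar_apply, hζ.pow_eq_one_iff_dvd] at hv
    rw [← ZMod.natCast_zmod_val v]
    exact (ZMod.natCast_eq_zero_iff _ _).2 hv
  have heinj2 : ∀ v, e v ^ 2 = 1 → v = 0 := fun v hv => by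
    rw [← AddChar.map_nsmul_eq_pow] at hv
    have h := heinj _ hv
    have hu : IsUnit ((2 : ℕ) : ZMod m) :=
      (ZMod.isUnit_iff_coprime 2 m).2 (Nat.coprime_two_left.2 hodd)
    rw [nsmul_eq_mul] at h
    exact (hu.mul_right_eq_zero).1 h
  have heq : ∀ v, e v ^ q = (e v)⁻¹ := fun v => by
    refine eq_inv_of_mul_eq_one_left ?_
    rw [← pow_succ, hcard, Nat.sub_add_cancel (by omega), AddChar.zmodChar_apply, ← pow_mul,
      show v.val * (2 * m) = m * (2 * v.val) by ring, pow_mul, hζ.pow_eq_one, one_pow]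
  have hadd : ∀ x y : K, (x + y) ^ q = x ^ q + y ^ q := fun x y => by
    simpa using map_add (FiniteField.frobeniusAlgHom F K) x y
  have hsub : ∀ x y : K, (x - y) ^ q = x ^ q - y ^ q := fun x y => by
    simpa using map_sub (FiniteField.frobeniusAlgHom F K) x y
  -- Frobenius inverts `e v`, as q ≡ -1 mod m, so it negates both factors and fixes their product.
  have hA : ∀ v, ∃ y, algebraMap F K y = δ * (e v - (e v)⁻¹) := fun v =>
    mem_range_algebraMap_of_pow_card_eq (by
      rw [← hq, mul_pow, hsub, inv_pow, heq, inv_inv, hδq]; ring)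
  have hB : ∀ v, ∃ y, algebraMap F K y = e v + (e v)⁻¹ := fun v =>
    mem_range_algebraMap_of_pow_card_eq (by
      rw [← hq, hadd, inv_pow, heq, inv_inv, add_comm])
  choose A hA using hA
  choose B hB using hB
  have hinj := (algebraMap F K).injective
  have hesub : ∀ v w, e (v - w) = e v * (e w)⁻¹ := fun v w => by
    rw [AddChar.map_sub_eq_div, div_eq_mul_inv]
  refine ⟨A, B, d, fun v => ⟨fun h => ?_, ?_⟩, fun v h => ?_, fun v => hinj ?_, fun v => hinj ?_,
    fun v v' w => hinj ?_, fun v v' w => hinj ?_, fun v v' w => hinj ?_⟩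
  · have h := congrArg (algebraMap F K) h
    rw [hA, map_zero, mul_eq_zero, or_iff_right hδ0, sub_eq_zero] at h
    exact heinj2 v (by rw [sq]; nth_rewrite 1 [h]; exact inv_mul_cancel₀ (he0 v))
  · rintro rfl
    exact hinj (by simp [hA])
  · have h := congrArg (algebraMap F K) h
    rw [hB, map_zero] at h
    have h' : e v ^ 2 = -1 := by
      have := he0 v
      field_simp at h
      linear_combination h
    have hv : e (v + v) ^ 2 = 1 := by
      rw [AddChar.map_add_eq_mul, ← sq, h']; norm_num
    have hv' : v + v = 0 := heinj2 _ hv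
    have : e (v + v) = -1 := by rw [AddChar.map_add_eq_mul, ← sq, h']
    rw [hv', AddChar.map_zero_eq_one] at this
    exact h2K (by linear_combination this)
  · rw [map_neg, hA, hA, AddChar.map_neg_eq_inv, inv_inv]; ring
  · rw [hB, hB, AddChar.map_neg_eq_inv, inv_inv]; ring
  · have hv := he0 v
    have hv' := he0 v'
    have hw := he0 w
    simp only [map_sub, map_mul, hA, hesub, AddChar.map_add_eq_mul]
    field_simp
    ring
  · have hv := he0 v
    have hv' := he0 v'
    have hw := he0 w
    simp only [map_sub, map_mul, map_neg, hA, hB, hesub, AddChar.map_add_eq_mul]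
    field_simp
    ring
  · have hv := he0 v
    have hv' := he0 v'
    have hw := he0 w
    simp only [map_sub, map_mul, map_neg, hA, hB, hesub, AddChar.map_add_eq_mul, ← hδ]
    field_simp
    ring

theorem exists_asds_of_isPrimePow {m : ℕ} [NeZero m] (hodd : Odd m)
    (hq : IsPrimePow (2 * m - 1)) :
    ∃ (B D : Finset (ZMod m)) (μ : ℕ),
      (μ : ℤ) = (B.card : ℤ) + (D.card : ℤ) - ((m : ℤ) + 1) / 2 ∧
      IsASDS B D B.card D.card μ ∧
      IsSymmMultiset (diffMultiset B D) := by
  classical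
  obtain ⟨k, hk⟩ := hodd
  have hm1 : m ≠ 1 := by
    rintro rfl
    exact hq.ne_one rfl
  obtain ⟨p, n, hp, hn, hpn⟩ := (isPrimePow_nat_iff _).1 hq
  have : Fact p.Prime := ⟨hp⟩
  let F := GaloisField p n
  have := Fintype.ofFinite F
  have hcard : Fintype.card F = 2 * m - 1 := by
    rw [Fintype.card_eq_nat_card, GaloisField.card p n hn.ne', hpn]
  have hF : ringChar F ≠ 2 := fun h => by
    have := FiniteField.even_card_iff_char_two.1 h
    omega
  obtain ⟨A, B, d, hA, hB, hAe, hBe, hAA, hAB, hBB⟩ := exists_sine_cosine ⟨k, hk⟩ (AlgebraicClosure F) hF hcard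
  -- As m is odd, 2m - 1 ≡ 1 mod 4; hence the odd function `A` gives an even sequence.
  have hneg : quadraticChar F (-1) = 1 := by
    rw [quadraticChar_neg_one hF, hcard, ZMod.χ₄_nat_one_mod_four (by omega)]
  have hone : (1 : ZMod m) ≠ 0 := by
    have : Fact (1 < m) := ⟨by omega⟩
    exact one_ne_zero
  have hA0 : ∀ v ≠ 0, A v ≠ 0 := fun v hv h => hv ((hA v).1 h)
  -- This sign forces `f 1 = -1`, so that the total -2 occurs at shift 1.
  set ε := quadraticChar F (A 1) with hε
  have hε1 : ε * ε = 1 := by rw [← sq]; exact quadraticChar_sq_one (hA0 1 hone)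
  set f : ZMod m → ℤ := fun v => -(ε * quadraticChar F (A v)) with hf
  set g : ZMod m → ℤ := fun v => quadraticChar F (B v) with hg
  have hf0 : f 0 = 0 := by simp [hf, (hA 0).2 rfl]
  have hfe : ∀ v, f (-v) = f v := fun v => by
    simp only [hf]
    rw [hAe, neg_eq_neg_one_mul (A v), map_mul, hneg, one_mul]
  have hfval : ∀ v ≠ 0, f v = 1 ∨ f v = -1 := fun v hv => by
    simp only [hf]
    rcases quadraticChar_dichotomy (hA0 v hv) with h | h <;>
      rcases quadraticChar_dichotomy (hA0 1 hone) with h' | h' <;> simp [hε, h, h']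
  have htotal : ∀ w, w ≠ 0 →
      autocorrelation (Function.update f 0 1) w + autocorrelation g w = 2 * f w := fun w hw => by
    have hscale : autocorrelation f w = autocorrelation (fun v => quadraticChar F (A v)) w :=
      Finset.sum_congr rfl fun v _ => by
        simp only [hf]
        linear_combination quadraticChar F (A v) * quadraticChar F (A (v + w)) * hε1
    rw [autocorrelation_update_zero hf0 hfe hw, hscale]
    have := sum_eq_zero_of_moebius hF hcard hA hB hAA hAB hBB hw
    linear_combination this
  have hf1 : f 1 = -1 := by simp only [hf, ← hε, hε1]
  refine exists_asds_of_autocorrelation (f := Function.update f 0 1) (g := g) ⟨k, hk⟩ ?_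
    (fun v => quadraticChar_dichotomy (hB v)) ?_ (fun v => by simp only [hg, hBe])
    (fun w hw => ?_) ⟨1, hone, by rw [htotal 1 hone, hf1]; rfl⟩
  · intro v
    by_cases hv : v = 0
    · simp [hv]
    · simpa [hv] using hfval v hv
  · intro v
    by_cases hv : v = 0
    · simp [hv]
    · simp [hv, hfe]
  · rw [htotal w hw]
    rcases hfval w hw with h | h <;> simp [h]

theorem mainTheorem6 (m : ℕ) [NeZero m] (hodd : Odd m)
    (hm : (m.Prime ∧ m ≡ 1 [MOD 4]) ∨ IsPrimePow (2 * m - 1)) :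
    ∃ (B D : Finset (ZMod m)) (μ : ℕ),
      (μ : ℤ) = (B.card : ℤ) + (D.card : ℤ) - ((m : ℤ) + 1) / 2 ∧
      IsASDS B D B.card D.card μ ∧
      IsSymmMultiset (diffMultiset B D) := by
  rcases hm with ⟨hp, h4⟩ | hq
  · exact exists_asds_of_prime hp h4
  · exact exists_asds_of_isPrimePow hodd hq
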